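/- Let $G$ be a group with a finitely generated abelian normal subgroup $A$ such that $\beta=G/A$ is a $PD_2^+$-group, i.e. an orientable Poincaré duality group of dimension 2: the trivial $\mathbb{Z}[\beta]$-module $\mathbb{Z}$ has a finite resolution by finitely generated projective $\mathbb{Z}[\beta]$-modules, $H^i(\beta;\mathbb{Z}[\beta])=0$ for $i\neq 2$, and $H^2(\beta;\mathbb{Z}[\beta])\cong\mathbb{Z}$ with trivial action of $\beta$. (Equivalently, $\beta$ is isomorphic to the fundamental group of an aspherical closed connected orientable surface.) Then the canonical projection $p:G\to\beta$ has a section, that is, there is a homomorphism $s:\beta\to G$ with $ps=\mathrm{id}_\beta$, if and only if there is an isomorphism of abelian groups $$G^{ab}\cong A/[G,A]\oplus\beta^{ab}.$$ -/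

import Mathlib

open scoped MonoidAlgebra

noncomputable section

universe u

/-- The augmentation `ℤ[β] → ℤ` of the integral group ring, sending every group element to `1`. -/
def augmentation (β : Type u) [Group β] : ℤ[β] →+* ℤ :=
  (MonoidAlgebra.lift ℤ ℤ β (1 : β →* ℤ)).toRingHom

/-- A finite resolution
`0 → P_length → ⋯ → P_1 → P_0 → ℤ → 0` of the trivial left `ℤ[β]`-module `ℤ` by finitely generated
projective left `ℤ[β]`-modules. The group `β` is *of type FP* if it has such a resolution. -/
structure FPResolution (β : Type u) [Group β] where
  /-- the modules of the resolution -/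
  P : ℕ → Type u
  [addCommGroup : ∀ i, AddCommGroup (P i)]
  [module : ∀ i, Module ℤ[β] (P i)]
  [finite : ∀ i, Module.Finite ℤ[β] (P i)]
  [projective : ∀ i, Module.Projective ℤ[β] (P i)]
  /-- the differentials -/
  d : ∀ i, P (i + 1) →ₗ[ℤ[β]] P i
  /-- the augmentation of the resolution; semilinearity over `augmentation β` says that it is
  `ℤ[β]`-linear for the trivial action on `ℤ` -/
  ε : P 0 →ₛₗ[augmentation β] ℤ
  ε_surjective : Function.Surjective ε
  exact_zero : Function.Exact (d 0) ε
  exact_succ : ∀ i, Function.Exact (d (i + 1)) (d i)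
  /-- a bound for the length of the resolution -/
  length : ℕ
  subsingleton_of_length_lt : ∀ i, length < i → Subsingleton (P i)

namespace FPResolution

attribute [instance] addCommGroup module finite projective

variable {β : Type u} [Group β] (R : FPResolution β)

/-- The module `Hom(P_i, ℤ[β])` of the dual complex. -/
def Dual (i : ℕ) : Type u := R.P i →ₗ[ℤ[β]] ℤ[β]

instance (i : ℕ) : AddCommGroup (R.Dual i) :=
  inferInstanceAs (AddCommGroup (R.P i →ₗ[ℤ[β]] ℤ[β]))

/-- `Hom(P_i, ℤ[β])` is a right `ℤ[β]`-module by `(f · r)(x) = f(x) r`. -/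
instance (i : ℕ) : Module ℤ[β]ᵐᵒᵖ (R.Dual i) :=
  inferInstanceAs (Module ℤ[β]ᵐᵒᵖ (R.P i →ₗ[ℤ[β]] ℤ[β]))

/-- The coboundary `Hom(P_i, ℤ[β]) → Hom(P_{i+1}, ℤ[β])`, `f ↦ f ∘ d`, of the dual complex, as a
map of right `ℤ[β]`-modules. -/
def coboundary (i : ℕ) : R.Dual i →ₗ[ℤ[β]ᵐᵒᵖ] R.Dual (i + 1) where
  toFun f := LinearMap.comp (show R.P i →ₗ[ℤ[β]] ℤ[β] from f) (R.d i)
  map_add' _ _ := rfl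
  map_smul' _ _ := rfl

/-- The cocycles of degree `i` of the dual complex. -/
def cocycles (i : ℕ) : Submodule ℤ[β]ᵐᵒᵖ (R.Dual i) :=
  LinearMap.ker (R.coboundary i)

/-- The coboundaries of degree `i` of the dual complex. -/
def coboundaries : (i : ℕ) → Submodule ℤ[β]ᵐᵒᵖ (R.Dual i)
  | 0 => ⊥
  | i + 1 => LinearMap.range (R.coboundary i)

/-- The cohomology group `H^i(β; ℤ[β])` with its right `ℤ[β]`-module structure, computed from the
resolution. -/
abbrev Cohomology (i : ℕ) : Type u :=
  R.cocycles i ⧸ (R.coboundaries i).submoduleOf (R.cocycles i)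

end FPResolution

/-- `β` is an orientable Poincaré duality group of dimension `n` (a `PD_n⁺`-group): it is of type FP,
`H^i(β; ℤ[β]) = 0` for `i ≠ n`, and `H^n(β; ℤ[β])` is infinite cyclic with trivial action of `β`.
The cohomology groups do not depend on the resolution. -/
def IsOrientablePDGroup (n : ℕ) (β : Type u) [Group β] : Prop :=
  ∃ R : FPResolution β,
    (∀ i, i ≠ n → Subsingleton (R.Cohomology i)) ∧
    ∃ e : R.Cohomology n ≃+ ℤ, ∀ (g : β) (x : R.Cohomology n),
      e (MulOpposite.op (MonoidAlgebra.single g (1 : ℤ)) • x) = e x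

end

/-!
The content of the theorem is that `H²(β; M) → H²(β; H₀(β; M))` is injective for an orientable
Poincaré duality group `β = G ⧸ A` of dimension 2, so that an extension of `β` by the module `A`
splits as soon as its image, an extension of `β` by the trivial module `A / [G, A]`, does.

Injectivity follows from the two facts about the dual complex that are used here. The vanishing of
`Hⁱ(β; ℤ[β])` for `i > 2` gives `Hⁱ(β; M) = 0` for `i > 2` and all `M`
(`FPResolution.cohomologyVanishes`), so `H²(β; -)` is right exact. Hence a 2-cocycle with values in
`I M`, with `I` the augmentation ideal, is a sum of terms `C (g - 1) m` with `m` in `M` and `C` a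
cocycle in `ℤ[β]`. As `β` acts trivially on `H²(β; ℤ[β])`, the cocycles `C (g - 1)` are coboundaries
(`FPResolution.exists_comp_d_eq_of_mem_augmentationSubmodule`).

To connect this with extensions, embed `A` in a larger module `W`, the product of a coinduced module
and the coinvariants of `A`, such that the inclusion of `A` extends to a derivation `D : G → W`. The
extension splits if and only if `D` can be corrected by a derivation `β → W` to take values in `A`,
and the obstruction is the image in `H²(β; A)` of a class in `H¹(β; W ⧸ A)`
(`FPResolution.exists_derivation`).

It remains to see that `A → A / [G, A]` extends to `G` when `Gᵃᵇ` and `A / [G, A] × βᵃᵇ` are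
isomorphic. In the exact sequence `A / [G, A] → Gᵃᵇ → βᵃᵇ → 0` of finitely generated abelian groups,
counting elements modulo `n` for all `n` shows that the first map is injective with pure image, so
the sequence splits (`exists_retraction_of_addEquiv_prod`). Here `βᵃᵇ` is finitely generated because
it is a quotient of the augmentation ideal (`FPResolution.fg_abelianization`).
-/

noncomputable section

universe u

/-! ### Cocycles with values in `I M` -/

open MonoidAlgebra in
/-- For a `ℤ[β]`-module `M`, the submodule `I M` generated by the elements `(g - 1) m`; here `I` is
the augmentation ideal, and `M ⧸ I M` is the module of coinvariants `H₀(β; M)`. -/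
def augmentationSubmodule (β : Type u) [Group β] (M : Type u) [AddCommGroup M] [Module ℤ[β] M] :
    Submodule ℤ[β] M :=
  Submodule.span ℤ[β] (Set.range fun j : β × M ↦ (single j.1 (1 : ℤ) - 1) • j.2)

namespace FPResolution

variable {β : Type u} [Group β] (R : FPResolution β)

lemma d_d_apply (i : ℕ) (x : R.P (i + 2)) : R.d i (R.d (i + 1) x) = 0 :=
  (R.exact_succ i).apply_apply_eq_zero x

lemma mem_cocycles {i : ℕ} (c : R.P i →ₗ[ℤ[β]] ℤ[β]) (hc : ∀ x, c (R.d i x) = 0) :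
    (show R.Dual i from c) ∈ R.cocycles i :=
  LinearMap.mem_ker.2 (show LinearMap.comp c (R.d i) = 0 from LinearMap.ext hc)

lemma exists_comp_d_eq_of_mk_eq_zero {i : ℕ} (z : R.cocycles (i + 1))
    (hz : (Submodule.Quotient.mk z : R.Cohomology (i + 1)) = 0) :
    ∃ b : R.P i →ₗ[ℤ[β]] ℤ[β],
      ∀ x, b (R.d i x) = (show R.P (i + 1) →ₗ[ℤ[β]] ℤ[β] from z.1) x := by
  obtain ⟨b, hb⟩ : z.1 ∈ LinearMap.range (R.coboundary i) :=
    (Submodule.Quotient.mk_eq_zero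
      ((R.coboundaries (i + 1)).submoduleOf (R.cocycles (i + 1)))).1 hz
  exact ⟨b, fun x ↦ LinearMap.congr_fun
    (show LinearMap.comp (show R.P i →ₗ[ℤ[β]] ℤ[β] from b) (R.d i) =
      (show R.P (i + 1) →ₗ[ℤ[β]] ℤ[β] from z.1) from hb) x⟩

/-- `H^{i+1}(β; M) = 0`, in terms of the resolution `R`: every cocycle with values in `M` is a
coboundary. -/
def CohomologyVanishes (i : ℕ) (M : Type u) [AddCommGroup M] [Module ℤ[β] M] : Prop :=
  ∀ c : R.P (i + 1) →ₗ[ℤ[β]] M, (∀ x, c (R.d (i + 1) x) = 0) →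
    ∃ b : R.P i →ₗ[ℤ[β]] M, ∀ x, b (R.d i x) = c x

lemma cohomologyVanishes_groupRing {i : ℕ} (h : Subsingleton (R.Cohomology (i + 1))) :
    R.CohomologyVanishes i ℤ[β] := fun c hc ↦
  R.exists_comp_d_eq_of_mk_eq_zero ⟨c, R.mem_cocycles c hc⟩ (Subsingleton.elim _ _)

/-- If `H^{i+1}(β; -) = 0` then `H^i(β; -)` is right exact. So a cocycle with values in the span of
`v₁, …, vₙ` is a combination `∑ Cⱼ vⱼ` of cocycles `Cⱼ` with values in `ℤ[β]`. -/
lemma exists_cocycle_decomposition {i : ℕ} {M : Type u} [AddCommGroup M] [Module ℤ[β] M]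
    (hv : ∀ (K : Type u) [AddCommGroup K] [Module ℤ[β] K], R.CohomologyVanishes i K)
    {J : Type u} [Fintype J] (v : J → M) (c : R.P i →ₗ[ℤ[β]] M) (hc : ∀ x, c (R.d i x) = 0)
    (hcv : ∀ x, c x ∈ Submodule.span ℤ[β] (Set.range v)) :
    ∃ C : J → R.P i →ₗ[ℤ[β]] ℤ[β], (∀ j x, C j (R.d i x) = 0) ∧ ∀ x, c x = ∑ j, C j x • v j := by
  classical
  let π : (J → ℤ[β]) →ₗ[ℤ[β]] M :=
    ∑ j, (LinearMap.toSpanSingleton ℤ[β] M (v j)) ∘ₗ LinearMap.proj j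
  have hπ (y : J → ℤ[β]) : π y = ∑ j, y j • v j := by simp [π]
  have hrange (x) : c x ∈ LinearMap.range π := by
    refine (Submodule.span_le.2 ?_) (hcv x)
    rintro _ ⟨j, rfl⟩
    exact ⟨Pi.single j 1, by simp [hπ, Pi.single_apply]⟩
  obtain ⟨C, hC⟩ := Module.projective_lifting_property π.rangeRestrict
    (c.codRestrict (LinearMap.range π) hrange) π.surjective_rangeRestrict
  have hC' (x) : π (C x) = c x := congrArg Subtype.val (LinearMap.congr_fun hC x)
  obtain ⟨b, hb⟩ := hv (LinearMap.ker π)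
    ((C ∘ₗ R.d i).codRestrict _ fun x ↦ by simp [hC', hc])
    (fun x ↦ Subtype.ext (by simp [d_d_apply]))
  have hb' (x) : (b (R.d i x) : J → ℤ[β]) = C (R.d i x) := congrArg Subtype.val (hb x)
  refine ⟨fun j ↦ LinearMap.proj j ∘ₗ (C - (LinearMap.ker π).subtype ∘ₗ b), fun j x ↦ ?_,
    fun x ↦ ?_⟩
  · simp [hb']
  · have : π (C x - b x) = c x := by
      rw [map_sub, hC', LinearMap.mem_ker.1 (b x).2, sub_zero]
    rw [← this, hπ]
    rfl

/-- Dimension shifting, downwards from the length of the resolution: if `H^i(β; ℤ[β])` vanishes for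
all `i > n` then so does `H^i(β; M)` for every module `M`. -/
lemma cohomologyVanishes {n : ℕ} (h : ∀ i, n < i → Subsingleton (R.Cohomology i)) {i : ℕ}
    (hi : n ≤ i) (M : Type u) [AddCommGroup M] [Module ℤ[β] M] : R.CohomologyVanishes i M := by
  obtain ⟨k, hk⟩ : ∃ k, R.length ≤ i + k := ⟨R.length, by omega⟩
  induction k generalizing i M with
  | zero =>
    intro c _
    have := R.subsingleton_of_length_lt (i + 1) (by omega)
    exact ⟨0, fun x ↦ by simp [Subsingleton.elim x 0]⟩
  | succ k ih =>
    intro c hc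
    obtain ⟨S, hS⟩ := Module.Finite.fg_top (R := ℤ[β]) (M := R.P (i + 1))
    obtain ⟨C, hC, hcC⟩ := R.exists_cocycle_decomposition
      (fun K _ _ ↦ ih (i := i + 1) (by omega) K (by omega)) (fun s : S ↦ c s) c hc fun x ↦ by
        have : c x ∈ (Submodule.span ℤ[β] (S : Set (R.P (i + 1)))).map c :=
          ⟨x, by rw [hS]; trivial, rfl⟩
        rw [Submodule.map_span] at this
        convert this using 2
        ext y
        simp
    choose b hb using fun s ↦
      R.cohomologyVanishes_groupRing (h (i + 1) (by omega)) (C s) (hC s)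
    exact ⟨∑ s : S, LinearMap.toSpanSingleton ℤ[β] M (c s) ∘ₗ b s, fun x ↦ by
      rw [hcC]; simp [hb]⟩

open MonoidAlgebra in
/-- Let `H^i(β; ℤ[β]) = 0` for `i > n + 1`, and let `β` act trivially on `H^{n+1}(β; ℤ[β])`. Then
the kernel of `H^{n+1}(β; M) → H^{n+1}(β; M ⧸ I M)` is zero: a cocycle with values in `I M` is the
coboundary of a cochain with values in `M`. This is the part of the duality isomorphism
`H^{n+1}(β; M) ≃ H₀(β; M)` that is used.

Such a cocycle is `∑ Cⱼ (gⱼ - 1) mⱼ` with cocycles `Cⱼ` in `ℤ[β]`, and the class of `Cⱼ (gⱼ - 1)` is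
zero because `gⱼ` acts trivially. -/
lemma exists_comp_d_eq_of_mem_augmentationSubmodule {n : ℕ}
    (h : ∀ i, n + 1 < i → Subsingleton (R.Cohomology i))
    (htriv : ∀ (g : β) (x : R.Cohomology (n + 1)), MulOpposite.op (single g (1 : ℤ)) • x = x)
    {M : Type u} [AddCommGroup M] [Module ℤ[β] M] (c : R.P (n + 1) →ₗ[ℤ[β]] M)
    (hc : ∀ x, c (R.d (n + 1) x) = 0) (hcI : ∀ x, c x ∈ augmentationSubmodule β M) :
    ∃ b : R.P n →ₗ[ℤ[β]] M, ∀ x, b (R.d n x) = c x := by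
  -- As `P (n + 1)` is finitely generated, finitely many of the generators of `I M` suffice.
  obtain ⟨s, hs⟩ : ∃ s : Finset (β × M), LinearMap.range c ≤
      Submodule.span ℤ[β] (Set.range fun j : s ↦ (single j.1.1 (1 : ℤ) - 1 : ℤ[β]) • j.1.2) := by
    obtain ⟨s, hs⟩ := CompleteLattice.IsCompactElement.exists_finset_of_le_iSup _
      ((Submodule.fg_iff_compact (LinearMap.range c)).1 (Submodule.FG.of_finite))
      (fun j : β × M ↦ Submodule.span ℤ[β] {(single j.1 (1 : ℤ) - 1 : ℤ[β]) • j.2})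
      (by
        rw [← Submodule.span_range_eq_iSup]
        rintro _ ⟨x, rfl⟩
        exact hcI x)
    refine ⟨s, hs.trans (iSup₂_le fun j hj ↦ Submodule.span_mono ?_)⟩
    rintro _ rfl
    exact ⟨⟨j, hj⟩, rfl⟩
  obtain ⟨C, hC, hcC⟩ := R.exists_cocycle_decomposition
    (fun K _ _ ↦ R.cohomologyVanishes h le_rfl K) _ c hc fun x ↦ hs ⟨x, rfl⟩
  have key (j : s) : ∃ b : R.P n →ₗ[ℤ[β]] ℤ[β],
      ∀ x, b (R.d n x) = C j x * (single j.1.1 (1 : ℤ) - 1) := by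
    let z : R.cocycles (n + 1) := ⟨C j, R.mem_cocycles _ (hC j)⟩
    obtain ⟨b, hb⟩ := R.exists_comp_d_eq_of_mk_eq_zero
      (MulOpposite.op (single j.1.1 (1 : ℤ)) • z - z) (by
        rw [Submodule.Quotient.mk_sub, Submodule.Quotient.mk_smul, htriv, sub_self])
    refine ⟨b, fun x ↦ (hb x).trans ?_⟩
    rw [mul_sub, mul_one]
    rfl
  choose b hb using key
  exact ⟨∑ j, LinearMap.toSpanSingleton ℤ[β] M j.1.2 ∘ₗ b j,
    fun x ↦ by simp [hb, hcC, mul_smul]⟩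

end FPResolution

/-! ### Derivations and the class of an extension -/

section Derivation

open MonoidAlgebra

variable {β : Type u} [Group β]

@[simp]
lemma augmentation_single (g : β) (n : ℤ) : augmentation β (single g n) = n := by
  simp [augmentation]

lemma single_sub_one_mem_ker_augmentation (g : β) :
    (single g (1 : ℤ) - 1 : ℤ[β]) ∈ RingHom.ker (augmentation β) := by
  simp [RingHom.mem_ker]

/-- The augmentation ideal, with `g ↦ g - 1`, is the target of the universal derivation on `β`. -/
lemma exists_linearMap_of_derivation {Q : Type*} [AddCommGroup Q] [Module ℤ[β] Q] (δ : β → Q)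
    (hδ : ∀ g h, δ (g * h) = δ g + single g (1 : ℤ) • δ h) :
    ∃ θ : RingHom.ker (augmentation β) →ₗ[ℤ[β]] Q,
      ∀ g, θ ⟨single g 1 - 1, single_sub_one_mem_ker_augmentation g⟩ = δ g := by
  let Θ : ℤ[β] →+ Q := (Finsupp.linearCombination ℤ δ).toAddMonoidHom.comp
    (coeffAddEquiv (R := ℤ) (M := β)).toAddMonoidHom
  have hΘ (g : β) (n : ℤ) : Θ (single g n) = n • δ g :=
    Finsupp.linearCombination_single ℤ n g
  have hδ1 : δ 1 = 0 := by simpa [← one_def] using hδ 1 1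
  -- Before restriction to the augmentation ideal, `Θ` fails to be linear by the term `Θ r`.
  have hmul (r x : ℤ[β]) : Θ (r * x) = r • Θ x + augmentation β x • Θ r := by
    induction r using induction_linear with
    | zero => simp
    | add r r' hr hr' => rw [add_mul, map_add, hr, hr', map_add, smul_add, add_smul]; abel
    | single g n =>
      induction x using induction_linear with
      | zero => simp
      | add x x' hx hx' => rw [mul_add, map_add, hx, hx', map_add, map_add, smul_add, add_smul]; abel
      | single h m =>
        have hn : (single g n : ℤ[β]) = n • single g 1 := by simp
        rw [single_mul_single, hΘ, hΘ, hΘ, hδ, augmentation_single, hn, smul_assoc,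
          smul_comm _ m, ← smul_assoc n m, smul_add, ← smul_assoc m n, smul_eq_mul, smul_eq_mul,
          mul_comm m n, add_comm]
  refine ⟨⟨⟨fun x ↦ Θ x, fun x y ↦ map_add Θ _ _⟩, fun r x ↦ ?_⟩, fun g ↦ ?_⟩
  · simp [hmul, (RingHom.mem_ker).1 x.2]
  · change Θ (single g 1 - 1) = δ g
    rw [map_sub, one_def, hΘ, hΘ, hδ1]
    simp

end Derivation

namespace FPResolution

open MonoidAlgebra

variable {β : Type u} [Group β] (R : FPResolution β)

/-- The identity of `ℤ` lifts to a map from the resolution to `ℤ[β]`. -/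
lemma exists_linearMap_augmentation_eq :
    ∃ f : R.P 0 →ₗ[ℤ[β]] ℤ[β], ∀ x, augmentation β (f x) = R.ε x := by
  let T : Submodule ℤ[β] (R.P 0 × ℤ[β]) :=
    { carrier := {y | augmentation β y.2 = R.ε y.1}
      add_mem' := fun {y z} hy hz ↦ by
        simp only [Set.mem_ofPred_eq] at hy hz
        simp [hy, hz]
      zero_mem' := by simp
      smul_mem' := fun r y hy ↦ by
        simp only [Set.mem_ofPred_eq] at hy
        simp [hy] }
  obtain ⟨s, hs⟩ := Module.projective_lifting_property (LinearMap.fst _ _ _ ∘ₗ T.subtype)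
    (LinearMap.id : R.P 0 →ₗ[ℤ[β]] R.P 0)
    (fun x ↦ ⟨⟨(x, algebraMap ℤ ℤ[β] (R.ε x)), by simp [T]⟩, rfl⟩)
  refine ⟨LinearMap.snd _ _ _ ∘ₗ T.subtype ∘ₗ s, fun x ↦ (s x).2.trans ?_⟩
  exact congrArg R.ε (LinearMap.congr_fun hs x)

/-- Let `M` be the kernel of `q : W → Q`, and let `θ : I → Q` be defined on the augmentation ideal.
The map `P 1 → I → Q` induced by `θ` lifts to `l : P 1 → W`, and the restriction of `l` to `P 2` is
a cocycle with values in `M`. If `l` can be chosen such that this cocycle is zero, then `θ` itself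
lifts to `W`. -/
lemma exists_lift_of_comp_d_eq_zero {W Q : Type u} [AddCommGroup W] [Module ℤ[β] W]
    [AddCommGroup Q] [Module ℤ[β] Q] (q : W →ₗ[ℤ[β]] Q) (hq : Function.Surjective q)
    (θ : RingHom.ker (augmentation β) →ₗ[ℤ[β]] Q)
    (f : R.P 0 →ₗ[ℤ[β]] ℤ[β]) (hf : ∀ x, augmentation β (f x) = R.ε x)
    (l : R.P 1 →ₗ[ℤ[β]] W)
    (hl : ∀ x (hx : f (R.d 0 x) ∈ RingHom.ker (augmentation β)), q (l x) = θ ⟨f (R.d 0 x), hx⟩)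
    (hl0 : ∀ x, l (R.d 1 x) = 0) :
    ∃ s : RingHom.ker (augmentation β) →ₗ[ℤ[β]] W, ∀ x, q (s x) = θ x := by
  -- `l` factors as `μ : N → W`, where `N` is the kernel of `ε`, alias the image of `d 0`.
  let N := LinearMap.ker R.ε
  let d₀ : R.P 1 →ₗ[ℤ[β]] N := (R.d 0).codRestrict N
    fun x ↦ LinearMap.mem_ker.2 (R.exact_zero.apply_apply_eq_zero x)
  have hd₀ : Function.Surjective d₀ := fun y ↦ by
    obtain ⟨x, hx⟩ := (R.exact_zero y).1 y.2
    exact ⟨x, Subtype.ext hx⟩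
  have hker : LinearMap.ker d₀ ≤ LinearMap.ker l := fun x hx ↦ by
    obtain ⟨y, rfl⟩ := (R.exact_succ 0 x).1 (congrArg Subtype.val hx)
    exact hl0 y
  let μ : N →ₗ[ℤ[β]] W :=
    (LinearMap.ker d₀).liftQ l hker ∘ₗ (d₀.quotKerEquivOfSurjective hd₀).symm.toLinearMap
  have hfN (y : N) : f y ∈ RingHom.ker (augmentation β) := by
    rw [RingHom.mem_ker, hf]; exact y.2
  have hμ (y : N) : q (μ y) = θ ⟨f y, hfN y⟩ := by
    obtain ⟨x, rfl⟩ := hd₀ y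
    have : μ (d₀ x) = l x := by
      have := (d₀.quotKerEquivOfSurjective hd₀).symm_apply_apply (Submodule.Quotient.mk x)
      rw [LinearMap.quotKerEquivOfSurjective_apply_mk] at this
      simp [μ, this]
    rw [this]
    exact hl x _
  -- With `ε p = 1` and `a = f p`, every `x` in the augmentation ideal is `f (x p) + x (1 - a)`,
  -- where `x p` is in `N` and `1 - a` is in the augmentation ideal.
  obtain ⟨p, hp⟩ := R.ε_surjective 1
  have ha : 1 - f p ∈ RingHom.ker (augmentation β) := by simp [RingHom.mem_ker, hf, hp]
  obtain ⟨w, hw⟩ := hq (θ ⟨1 - f p, ha⟩)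
  let ν : RingHom.ker (augmentation β) →ₗ[ℤ[β]] N :=
    (LinearMap.toSpanSingleton ℤ[β] _ p ∘ₗ Submodule.subtype _).codRestrict N fun x ↦ by
      simp [N, (RingHom.mem_ker).1 x.2]
  refine ⟨μ ∘ₗ ν + LinearMap.toSpanSingleton ℤ[β] _ w ∘ₗ Submodule.subtype _, fun x ↦ ?_⟩
  change q (μ (ν x) + (x : ℤ[β]) • w) = θ x
  rw [map_add, hμ, map_smul, hw, ← map_smul, ← map_add]
  exact congrArg θ (Subtype.ext (by simp [ν, mul_sub]))

/-- Let `p : G → β` be surjective, and let the derivation `D : G → W` map `ker p` to a submodule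
`j : M → W`. Then `D` induces a derivation `β → W ⧸ M`, whose class in `H¹(β; W ⧸ M)` goes to a
class in `H²(β; M)`. If `ψ` extends `M → M ⧸ I M` to `W`, this class vanishes in `H²(β; M ⧸ I M)`,
and by duality it vanishes. So there is a derivation `E : G → M` which agrees with `D` on `ker p`.
-/
theorem exists_derivation (h : ∀ i, 2 < i → Subsingleton (R.Cohomology i))
    (htriv : ∀ (g : β) (x : R.Cohomology 2), MulOpposite.op (single g (1 : ℤ)) • x = x)
    {G : Type*} [Group G] (p : G →* β) (hp : Function.Surjective p)
    {M W : Type u} [AddCommGroup M] [Module ℤ[β] M] [AddCommGroup W] [Module ℤ[β] W]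
    (j : M →ₗ[ℤ[β]] W) (hj : Function.Injective j)
    (D : G → W) (hD : ∀ g h, D (g * h) = D g + single (p g) (1 : ℤ) • D h)
    (hDj : ∀ k ∈ p.ker, D k ∈ LinearMap.range j)
    (ψ : W →ₗ[ℤ[β]] M ⧸ augmentationSubmodule β M)
    (hψ : ∀ m, ψ (j m) = Submodule.Quotient.mk m) :
    ∃ E : G → M, (∀ g h, E (g * h) = E g + single (p g) (1 : ℤ) • E h) ∧
      ∀ k ∈ p.ker, j (E k) = D k := by
  let q := (LinearMap.range j).mkQ
  have hq0 (w : W) : q w = 0 ↔ w ∈ LinearMap.range j := by simp [q]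
  obtain ⟨t, ht⟩ := hp.hasRightInverse
  have hqD (g : G) : q (D (t (p g))) = q (D g) := by
    have hk : (t (p g))⁻¹ * g ∈ p.ker := by simp [MonoidHom.mem_ker, ht (p g)]
    have := hD (t (p g)) ((t (p g))⁻¹ * g)
    rw [mul_inv_cancel_left] at this
    rw [this, map_add, map_smul, (hq0 _).2 (hDj _ hk), smul_zero, add_zero]
  obtain ⟨θ, hθ⟩ := exists_linearMap_of_derivation (fun b ↦ q (D (t b))) fun g h ↦ by
    have := hqD (t g * t h)
    rw [map_mul, ht, ht] at this
    rw [this, hD, map_add, map_smul, ht]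
  obtain ⟨f, hf⟩ := R.exists_linearMap_augmentation_eq
  let fd : R.P 1 →ₗ[ℤ[β]] RingHom.ker (augmentation β) :=
    (f ∘ₗ R.d 0).codRestrict _ fun x ↦ by
      simp [RingHom.mem_ker, hf, R.exact_zero.apply_apply_eq_zero x]
  have hfd (x) : fd (R.d 1 x) = 0 := Subtype.ext (by simp [fd, R.d_d_apply])
  obtain ⟨l, hl⟩ := Module.projective_lifting_property q (θ ∘ₗ fd) (Submodule.mkQ_surjective _)
  have hl (x) : q (l x) = θ (fd x) := LinearMap.congr_fun hl x
  -- `c` is a cocycle that represents the class in `H²(β; M)`.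
  let e := LinearEquiv.ofInjective j hj
  obtain ⟨c, hc⟩ : ∃ c : R.P 2 →ₗ[ℤ[β]] M, ∀ x, j (c x) = l (R.d 1 x) :=
    ⟨e.symm.toLinearMap ∘ₗ (l ∘ₗ R.d 1).codRestrict (LinearMap.range j)
      fun x ↦ (hq0 _).1 (by simp [hl, hfd]),
      fun x ↦ congrArg Subtype.val (e.apply_symm_apply ⟨l (R.d 1 x), _⟩)⟩
  -- It is the coboundary of `ψ ∘ l` modulo `I M`.
  obtain ⟨b, hb⟩ := Module.projective_lifting_property (augmentationSubmodule β M).mkQ (ψ ∘ₗ l)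
    (Submodule.mkQ_surjective _)
  have hb (x) : (augmentationSubmodule β M).mkQ (b x) = ψ (l x) := LinearMap.congr_fun hb x
  obtain ⟨b', hb'⟩ := R.exists_comp_d_eq_of_mem_augmentationSubmodule (n := 1) h htriv
    (c - b ∘ₗ R.d 1)
    (fun x ↦ by
      have : c (R.d 2 x) = 0 := hj (by rw [hc, R.d_d_apply, map_zero, map_zero])
      simp [this, R.d_d_apply])
    (fun x ↦ by
      rw [← Submodule.Quotient.mk_eq_zero, ← Submodule.mkQ_apply, LinearMap.sub_apply, map_sub,
        LinearMap.comp_apply, hb, ← hc, hψ, Submodule.mkQ_apply, sub_self])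
  obtain ⟨s, hs⟩ := R.exists_lift_of_comp_d_eq_zero q (Submodule.mkQ_surjective _) θ f hf
    (l - j ∘ₗ (b + b'))
    (fun x hx ↦ by
      have : q (j (b x + b' x)) = 0 := (hq0 _).2 ⟨_, rfl⟩
      simp only [LinearMap.sub_apply, LinearMap.comp_apply, LinearMap.add_apply, map_sub, this,
        sub_zero, hl]
      rfl)
    (fun x ↦ by simp [hb', ← hc])
  -- Now `E` is `D` minus the derivation of `β` that belongs to the lift `s` of `θ`.
  let S (b : β) : W := s ⟨single b 1 - 1, single_sub_one_mem_ker_augmentation b⟩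
  have hS (g h : β) : S (g * h) = S g + single g (1 : ℤ) • S h := by
    rw [← map_smul, ← map_add]
    exact congrArg s (Subtype.ext (by simp [mul_sub, single_mul_single]))
  have hSD (g : G) : D g - S (p g) ∈ LinearMap.range j := by
    rw [← hq0, map_sub, hs, hθ, hqD, sub_self]
  choose E hE using hSD
  refine ⟨E, fun g h ↦ hj ?_, fun k hk ↦ ?_⟩
  · rw [map_add, map_smul, hE, hE, hE, hD, map_mul, hS, smul_sub]
    abel
  · have hS1 : S 1 = 0 := by simpa [← one_def] using hS 1 1
    rw [hE, MonoidHom.mem_ker.1 hk, hS1, sub_zero]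

end FPResolution

/-! ### The abelian normal subgroup as a module -/

section Coinduced

open MonoidAlgebra

variable (β : Type u) [Group β] (M : Type u) [AddCommGroup M]

/-- The functions `β → M`, with `(g u)(x) = u (x g)`. This is the `β`-module coinduced from the
abelian group `M`. -/
def coinducedRepresentation : Representation ℤ β (β → M) where
  toFun g := LinearMap.funLeft ℤ M (· * g)
  map_one' := by ext; simp [LinearMap.funLeft_apply]
  map_mul' g h := by ext; simp [LinearMap.funLeft_apply, mul_assoc]

lemma single_smul_coinduced (g : β) (u : (coinducedRepresentation β M).asModule) (x : β) :
    (coinducedRepresentation β M).asModuleEquiv (single g (1 : ℤ) • u) x =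
      (coinducedRepresentation β M).asModuleEquiv u (x * g) := by
  rw [Representation.single_smul, one_smul]
  rfl

variable {M} in
/-- The embedding `m ↦ (x ↦ x m)` of a module into the module coinduced from its underlying abelian
group. -/
def coinducedEmbedding [Module ℤ[β] M] : M →ₗ[ℤ[β]] (coinducedRepresentation β M).asModule :=
  equivariantOfLinearOfComm (R := ℤ)
    (AddMonoidHom.toIntLinearMap
      ((coinducedRepresentation β M).asModuleEquiv.symm.toAddMonoidHom.comp
        (AddMonoidHom.mk' (fun m x ↦ single x (1 : ℤ) • m) fun m m' ↦ by ext; simp)))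
    fun g m ↦ (coinducedRepresentation β M).asModuleEquiv.injective <| funext fun x ↦ by
      rw [single_smul_coinduced]
      change single x (1 : ℤ) • single g (1 : ℤ) • m = single (x * g) (1 : ℤ) • m
      rw [smul_smul, single_mul_single, one_mul]

variable {M} in
lemma coinducedEmbedding_apply [Module ℤ[β] M] (m : M) (x : β) :
    (coinducedRepresentation β M).asModuleEquiv (coinducedEmbedding β m) x =
      single x (1 : ℤ) • m := rfl

lemma coinducedEmbedding_injective [Module ℤ[β] M] :
    Function.Injective (coinducedEmbedding β (M := M)) := fun m m' h ↦ by
  have := congrFun (congrArg (coinducedRepresentation β M).asModuleEquiv h) 1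
  simpa [coinducedEmbedding_apply, ← one_def] using this

variable {β M} in
lemma single_smul_coinvariants [Module ℤ[β] M] (g : β) (x : M ⧸ augmentationSubmodule β M) :
    single g (1 : ℤ) • x = x := by
  obtain ⟨m, rfl⟩ := Submodule.Quotient.mk_surjective _ x
  rw [← Submodule.Quotient.mk_smul, Submodule.Quotient.eq]
  refine Submodule.subset_span ⟨(g, m), ?_⟩
  simp [sub_smul]

end Coinduced

section Conjugation

open MonoidAlgebra
open scoped IsMulCommutative

variable {G : Type u} [Group G] (A : Subgroup G) [A.Normal] [IsMulCommutative A]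

/-- The action of `G ⧸ A` by conjugation on the abelian normal subgroup `A`. -/
def conjQuotient : G ⧸ A →* MulAut A :=
  QuotientGroup.lift A MulAut.conjNormal fun a ha ↦ by
    ext b
    have := congrArg Subtype.val (mul_comm' (⟨a, ha⟩ : A) b)
    simp_all

/-- The abelian normal subgroup `A`, written additively, as a representation of `G ⧸ A`. -/
def conjRepresentation : Representation ℤ (G ⧸ A) (Additive A) where
  toFun g := (MonoidHom.toAdditive (conjQuotient A g).toMonoidHom).toIntLinearMap
  map_one' := by ext; simp
  map_mul' g h := by ext; simp

/-- The abelian normal subgroup `A` as a `ℤ[G ⧸ A]`-module. -/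
abbrev ConjModule : Type u := (conjRepresentation A).asModule

namespace ConjModule

variable {A}

/-- An element of `A` as an element of the module. -/
def of (a : A) : ConjModule A := (conjRepresentation A).asModuleEquiv.symm (.ofMul a)

lemma of_surjective : Function.Surjective (of (A := A)) := fun m ↦
  ⟨((conjRepresentation A).asModuleEquiv m).toMul, rfl⟩

lemma of_injective : Function.Injective (of (A := A)) := fun _ _ h ↦ h

lemma of_mul (a b : A) : of (a * b) = of a + of b := rfl

lemma single_smul_of (g : G) (a : A) :
    single (g : G ⧸ A) (1 : ℤ) • of a = of (MulAut.conjNormal g a) := by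
  rw [of, Representation.single_smul, one_smul]
  rfl

end ConjModule

/-- The canonical map from `A` to the coinvariants of the module `A`. -/
def toCoinvariants :
    A →* Multiplicative (ConjModule A ⧸ augmentationSubmodule (G ⧸ A) (ConjModule A)) where
  toFun a := .ofAdd (Submodule.Quotient.mk (ConjModule.of a))
  map_one' := rfl
  map_mul' _ _ := rfl

lemma subgroupOf_le_ker_toCoinvariants :
    (⁅(⊤ : Subgroup G), A⁆).subgroupOf A ≤ (toCoinvariants A).ker := by
  suffices H : ⁅(⊤ : Subgroup G), A⁆ ≤ (toCoinvariants A).ker.map A.subtype by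
    intro x hx
    obtain ⟨y, hy, hyx⟩ := H (Subgroup.mem_subgroupOf.1 hx)
    rwa [← Subtype.ext hyx]
  refine Subgroup.commutator_le.2 fun g _ a ha ↦
    ⟨MulAut.conjNormal g ⟨a, ha⟩ * ⟨a, ha⟩⁻¹, ?_, by simp [commutatorElement_def]⟩
  change toCoinvariants A _ = 1
  rw [map_mul, map_inv, mul_inv_eq_one]
  refine congrArg Multiplicative.ofAdd ?_
  rw [← ConjModule.single_smul_of, Submodule.Quotient.mk_smul, single_smul_coinvariants]

/-- The canonical map from `A / [G, A]` to the coinvariants of the module `A`. -/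
def quotientCommutatorToCoinvariants :
    A ⧸ (⁅(⊤ : Subgroup G), A⁆).subgroupOf A →*
      Multiplicative (ConjModule A ⧸ augmentationSubmodule (G ⧸ A) (ConjModule A)) :=
  QuotientGroup.lift _ (toCoinvariants A) (subgroupOf_le_ker_toCoinvariants A)

variable {A}

lemma quotientCommutatorToCoinvariants_mk (a : A) :
    (quotientCommutatorToCoinvariants A (QuotientGroup.mk a)).toAdd =
      Submodule.Quotient.mk (ConjModule.of a) := rfl

/-- If `e : G → A` is a crossed homomorphism which is the identity on `A`, then `g ↦ (e g)⁻¹ g` is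
a homomorphism, and it induces a section of `G → G ⧸ A`. -/
lemma exists_section_of_crossedHom (e : G → A)
    (he : ∀ g h, e (g * h) = e g * MulAut.conjNormal g (e h)) (heA : ∀ a : A, e a = a) :
    ∃ s : G ⧸ A →* G, (QuotientGroup.mk' A).comp s = MonoidHom.id (G ⧸ A) := by
  let r : G →* G := MonoidHom.mk' (fun g ↦ (e g : G)⁻¹ * g) fun g h ↦ by
    have := congrArg Subtype.val (mul_comm' (e g) (MulAut.conjNormal g (e h)))
    simp only [Subgroup.coe_mul, MulAut.conjNormal_apply] at this
    rw [he, Subgroup.coe_mul, MulAut.conjNormal_apply, this]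
    group
  refine ⟨QuotientGroup.lift A r fun a ha ↦ by simp [r, heA ⟨a, ha⟩], ?_⟩
  ext g
  simp [r]

/-- If `G → G ⧸ A` splits after division by `[G, A]`, and `G ⧸ A` has the properties of a duality
group that `FPResolution.exists_derivation` asks for, then it splits. -/
theorem exists_section_of_retraction (R : FPResolution (G ⧸ A))
    (h : ∀ i, 2 < i → Subsingleton (R.Cohomology i))
    (htriv : ∀ (g : G ⧸ A) (x : R.Cohomology 2), MulOpposite.op (single g (1 : ℤ)) • x = x)
    (φ : G →* A ⧸ (⁅(⊤ : Subgroup G), A⁆).subgroupOf A)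
    (hφ : ∀ a : A, φ a = QuotientGroup.mk a) :
    ∃ s : G ⧸ A →* G, (QuotientGroup.mk' A).comp s = MonoidHom.id (G ⧸ A) := by
  obtain ⟨t, ht⟩ := (QuotientGroup.mk'_surjective A).hasRightInverse
  have ht (x) : ((t x : G) : G ⧸ A) = x := ht x
  let W₀ := (coinducedRepresentation (G ⧸ A) (ConjModule A)).asModule
  let eW : W₀ ≃ₗ[ℤ] (G ⧸ A → ConjModule A) :=
    (coinducedRepresentation (G ⧸ A) (ConjModule A)).asModuleEquiv
  -- After coinduction the extension splits: `A → W₀` extends to a derivation `δ` on `G`.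
  let δ₀ (g : G) (x : G ⧸ A) : A := ⟨t x * g * (t (x * g))⁻¹, by
    rw [← QuotientGroup.eq_one_iff]; simp [ht]⟩
  let δ (g : G) : W₀ := eW.symm fun x ↦ ConjModule.of (δ₀ g x)
  have hδ (g h : G) : δ (g * h) = δ g + single (g : G ⧸ A) (1 : ℤ) • δ h := by
    refine eW.injective (funext fun x ↦ ?_)
    rw [map_add, Pi.add_apply]
    refine Eq.trans ?_ (congrArg _ (single_smul_coinduced _ _ _ _ _).symm)
    change ConjModule.of (δ₀ (g * h) x) = ConjModule.of (δ₀ g x) + ConjModule.of (δ₀ h (x * g))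
    rw [← ConjModule.of_mul]
    congr 1
    ext
    simp [δ₀, mul_assoc]
  let T := ConjModule A ⧸ augmentationSubmodule (G ⧸ A) (ConjModule A)
  let j : ConjModule A →ₗ[ℤ[G ⧸ A]] W₀ × T :=
    (coinducedEmbedding (G ⧸ A)).prod (Submodule.mkQ _)
  let D (g : G) : W₀ × T := (δ g, (quotientCommutatorToCoinvariants A (φ g)).toAdd)
  have hDA (a : A) : D a = j (ConjModule.of a) := by
    refine Prod.ext (eW.injective (funext fun x ↦ ?_)) ?_
    · refine Eq.trans ?_ (coinducedEmbedding_apply _ _ _).symm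
      conv_rhs => rw [← ht x, ConjModule.single_smul_of]
      change ConjModule.of (δ₀ a x) = _
      congr 1
      ext
      simp [δ₀, (QuotientGroup.eq_one_iff (a : G)).2 a.2]
    · change (quotientCommutatorToCoinvariants A (φ a)).toAdd = _
      rw [hφ, quotientCommutatorToCoinvariants_mk]
      rfl
  obtain ⟨E, hE, hEA⟩ := R.exists_derivation h htriv (QuotientGroup.mk' A)
    (QuotientGroup.mk'_surjective A) j
    (fun x y hxy ↦ coinducedEmbedding_injective _ _ (congrArg Prod.fst hxy)) D
    (fun g h ↦ Prod.ext (hδ g h) (by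
      simp only [D, map_mul, toAdd_mul, Prod.snd_add, Prod.smul_snd]
      exact congrArg _ (single_smul_coinvariants _ _).symm))
    (fun k hk ↦ ⟨_, (hDA ⟨k, by simpa using hk⟩).symm⟩) (LinearMap.snd _ _ _) (fun _ ↦ rfl)
  choose e he using fun g ↦ ConjModule.of_surjective (E g)
  refine exists_section_of_crossedHom e (fun g h ↦ ConjModule.of_injective ?_)
    fun a ↦ ConjModule.of_injective ?_
  · rw [ConjModule.of_mul, he, hE, ← ConjModule.single_smul_of, he, he]
    rfl
  · have hj : Function.Injective j := fun x y hxy ↦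
      coinducedEmbedding_injective _ _ (congrArg Prod.fst hxy)
    rw [he]
    exact hj ((hEA a (by simp)).trans (hDA a))

end Conjugation

/-! ### Split exact sequences of finitely generated abelian groups -/

section AbelianGroup

variable {T X B : Type*} [AddCommGroup T] [AddCommGroup X] [AddCommGroup B]

/-- A finitely generated abelian group is a finite product of cyclic groups; the infinite ones
appear as `ZMod 0`. -/
lemma exists_addEquiv_pi_zmod (B : Type*) [AddCommGroup B] [AddGroup.FG B] :
    ∃ (ι : Type) (_ : Fintype ι) (m : ι → ℕ), Nonempty (B ≃+ ∀ i, ZMod (m i)) := by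
  classical
  obtain ⟨n, ι, _, p, _, e, ⟨f⟩⟩ := AddCommGroup.equiv_free_prod_directSum_zmod B
  refine ⟨Fin n ⊕ ι, inferInstance, Sum.elim (fun _ ↦ 0) fun i ↦ p i ^ e i, ⟨f.trans ?_⟩⟩
  refine (AddEquiv.prodCongr (Finsupp.linearEquivFunOnFinite ℤ ℤ (Fin n)).toAddEquiv
    (DirectSum.addEquivProd _)).trans ?_
  exact (LinearEquiv.sumPiEquivProdPi ℤ (Fin n) ι
    (fun i ↦ ZMod (Sum.elim (fun _ ↦ 0) (fun i ↦ p i ^ e i) i))).symm.toAddEquiv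

/-- A finitely generated abelian group has no nonzero infinitely divisible elements. -/
lemma eq_zero_of_forall_exists_nsmul [AddGroup.FG T] (t : T)
    (h : ∀ n : ℕ, 0 < n → ∃ t', t = n • t') : t = 0 := by
  obtain ⟨ι, _, m, ⟨e⟩⟩ := exists_addEquiv_pi_zmod T
  apply e.injective
  rw [map_zero]
  ext i
  rw [Pi.zero_apply]
  have h' (n : ℕ) (hn : 0 < n) : ∃ c : ZMod (m i), e t i = n • c := by
    obtain ⟨t', rfl⟩ := h n hn
    exact ⟨e t' i, by simp⟩
  generalize e t i = c at h'
  generalize m i = k at c h'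
  obtain rfl | hk := Nat.eq_zero_or_pos k
  · have key (c : ℤ) (h : ∀ n : ℕ, 0 < n → ∃ c' : ℤ, c = n • c') : c = 0 := by
      obtain ⟨c', hc'⟩ := h (c.natAbs + 1) (by omega)
      rw [nsmul_eq_mul] at hc'
      exact Int.eq_zero_of_abs_lt_dvd ⟨c', hc'⟩ (by push_cast; exact lt_add_one _)
    exact key c h'
  · obtain ⟨c', rfl⟩ := h' k hk
    simp

/-- Let `T → X → B → 0` be exact with `X ≃ T × B`, all finitely generated. Counting `X / n` shows
that `T / n → X / n` is injective. -/
lemma exists_eq_nsmul_of_map_eq_nsmul [AddGroup.FG T] [AddGroup.FG X] [AddGroup.FG B] (α : T →+ X)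
    (q : X →+ B) (hq : Function.Surjective q) (hexact : ∀ x, q x = 0 ↔ x ∈ α.range)
    (f : X ≃+ T × B) {n : ℕ} (hn : 0 < n) (t : T) (x : X) (htx : α t = n • x) :
    ∃ t', t = n • t' := by
  have := AddSubgroup.finiteIndex_range_nsmulAddMonoidHom_of_fg T hn.ne'
  have := AddSubgroup.finiteIndex_range_nsmulAddMonoidHom_of_fg X hn.ne'
  have := AddSubgroup.finiteIndex_range_nsmulAddMonoidHom_of_fg B hn.ne'
  set T' := T ⧸ (nsmulAddMonoidHom (α := T) n).range
  set X' := X ⧸ (nsmulAddMonoidHom (α := X) n).range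
  set B' := B ⧸ (nsmulAddMonoidHom (α := B) n).range
  let α' : T' →+ X' := QuotientAddGroup.map _ _ α (by rintro _ ⟨y, rfl⟩; exact ⟨α y, by simp⟩)
  let q' : X' →+ B' := QuotientAddGroup.map _ _ q (by rintro _ ⟨y, rfl⟩; exact ⟨q y, by simp⟩)
  have hq' : Function.Surjective q' := by
    intro b
    obtain ⟨b, rfl⟩ := QuotientAddGroup.mk_surjective b
    obtain ⟨x, rfl⟩ := hq b
    exact ⟨x, rfl⟩
  have hker (y : X') (hy : q' y = 0) : ∃ s, α' s = y := by
    obtain ⟨y, rfl⟩ := QuotientAddGroup.mk_surjective y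
    obtain ⟨b, hb⟩ := (QuotientAddGroup.eq_zero_iff (q y)).1 hy
    obtain ⟨z, rfl⟩ := hq b
    obtain ⟨s, hs⟩ := (hexact (y - n • z)).1 (by simpa [sub_eq_zero] using hb.symm)
    refine ⟨s, (congrArg QuotientAddGroup.mk hs).trans ?_⟩
    rw [QuotientAddGroup.mk_sub, sub_eq_self]
    exact (QuotientAddGroup.eq_zero_iff _).2 ⟨z, rfl⟩
  have hcard : Nat.card T' * Nat.card B' ≤ Nat.card X' := by
    rw [← Nat.card_prod]
    let F : X' →+ T' × B' := QuotientAddGroup.lift _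
      (((QuotientAddGroup.mk' _).prodMap (QuotientAddGroup.mk' _)).comp f.toAddMonoidHom) (by
        rintro _ ⟨y, rfl⟩
        refine Prod.ext ?_ ?_
        · exact (QuotientAddGroup.eq_zero_iff _).2 ⟨(f y).1, by simp⟩
        · exact (QuotientAddGroup.eq_zero_iff _).2 ⟨(f y).2, by simp⟩)
    refine Nat.card_le_card_of_surjective F ?_
    rintro ⟨t, b⟩
    obtain ⟨t, rfl⟩ := QuotientAddGroup.mk_surjective t
    obtain ⟨b, rfl⟩ := QuotientAddGroup.mk_surjective b
    refine ⟨QuotientAddGroup.mk (f.symm (t, b)), ?_⟩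
    change ((QuotientAddGroup.mk' _).prodMap (QuotientAddGroup.mk' _)) (f (f.symm (t, b))) = _
    rw [f.apply_symm_apply]
    rfl
  have hcard' : Nat.card X' = Nat.card B' * Nat.card q'.ker := by
    rw [AddSubgroup.card_eq_card_quotient_mul_card_addSubgroup q'.ker,
      Nat.card_congr (QuotientAddGroup.quotientKerEquivOfSurjective q' hq').toEquiv]
  have hle : Nat.card T' ≤ Nat.card q'.ker := by
    rw [hcard', mul_comm] at hcard
    exact Nat.le_of_mul_le_mul_left hcard Nat.card_pos
  have hα'0 (s : T') : q' (α' s) = 0 := by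
    obtain ⟨s, rfl⟩ := QuotientAddGroup.mk_surjective s
    exact congrArg QuotientAddGroup.mk ((hexact (α s)).2 ⟨s, rfl⟩)
  have hinj := (Function.Surjective.bijective_of_nat_card_le
    (f := fun s : T' ↦ (⟨α' s, hα'0 s⟩ : q'.ker))
    (fun y ↦ (hker y y.2).imp fun s hs ↦ Subtype.ext hs) hle).1
  have h0 : (QuotientAddGroup.mk t : T') = 0 := hinj <| Subtype.ext <| by
    change (QuotientAddGroup.mk (α t) : X') = α' 0
    rw [map_zero]
    exact (QuotientAddGroup.eq_zero_iff _).2 ⟨x, htx.symm⟩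
  obtain ⟨t', ht'⟩ := (QuotientAddGroup.eq_zero_iff _).1 h0
  exact ⟨t', ht'.symm⟩

/-- Let `T → X → B → 0` be an exact sequence of finitely generated abelian groups. If there is any
isomorphism `X ≃ T × B`, then `T → X` has a retraction. (Miyata's theorem for modules over `ℤ`.) -/
theorem exists_retraction_of_addEquiv_prod [AddGroup.FG T] [AddGroup.FG B] (α : T →+ X)
    (q : X →+ B) (hq : Function.Surjective q) (hexact : ∀ x, q x = 0 ↔ x ∈ α.range)
    (f : X ≃+ T × B) : ∃ r : X →+ T, ∀ t, r (α t) = t := by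
  have : AddGroup.FG X := AddGroup.fg_of_surjective (f := f.symm.toAddMonoidHom) f.symm.surjective
  have hpure {n : ℕ} (hn : 0 < n) := exists_eq_nsmul_of_map_eq_nsmul α q hq hexact f hn
  have hα : Function.Injective α := (injective_iff_map_eq_zero α).2 fun t ht ↦
    eq_zero_of_forall_exists_nsmul t fun n hn ↦ hpure hn t 0 (by simp [ht])
  -- As the image of `α` is pure, the generators of the cyclic summands of `B` lift to elements of
  -- the same order.
  classical
  obtain ⟨ι, _, m, ⟨e⟩⟩ := exists_addEquiv_pi_zmod B
  have hlift (i : ι) : ∃ x, q x = e.symm (Pi.single i 1) ∧ m i • x = 0 := by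
    obtain ⟨x, hx⟩ := hq (e.symm (Pi.single i 1))
    obtain hm | hm := Nat.eq_zero_or_pos (m i)
    · exact ⟨x, hx, by rw [hm, zero_smul]⟩
    · obtain ⟨t, ht⟩ := (hexact (m i • x)).1 (by
        rw [map_nsmul, hx, ← map_nsmul, ← Pi.single_smul]; simp)
      obtain ⟨t', rfl⟩ := hpure hm t x ht
      refine ⟨x - α t', ?_, by rw [smul_sub, ← ht, map_nsmul, sub_self]⟩
      rw [map_sub, (hexact (α t')).2 ⟨t', rfl⟩, sub_zero, hx]
  choose x hx hmx using hlift
  let s (i : ι) : ZMod (m i) →+ X := ZMod.lift (m i) ⟨zmultiplesHom X (x i), by simp [hmx]⟩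
  have hs (i : ι) (c : ZMod (m i)) : q (s i c) = e.symm (Pi.single i c) := by
    obtain ⟨k, rfl⟩ := ZMod.intCast_surjective c
    rw [ZMod.lift_coe]
    change q (zmultiplesHom X (x i) k) = _
    rw [zmultiplesHom_apply, map_zsmul, hx, ← map_zsmul, ← Pi.single_smul, zsmul_eq_mul, mul_one]
  let S : B →+ X := (∑ i, (s i).comp (Pi.evalAddMonoidHom _ i)).comp e.toAddMonoidHom
  have hS (b : B) : q (S b) = b := by
    have : S b = ∑ i, s i (e b i) := by simp [S]
    rw [this, map_sum]
    simp_rw [hs]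
    rw [← map_sum, Finset.univ_sum_single, e.symm_apply_apply]
  have hr (y : X) : ∃ t, α t = y - S (q y) := (hexact _).1 (by rw [map_sub, hS, sub_self])
  choose r hr using hr
  refine ⟨AddMonoidHom.mk' r fun y z ↦ hα ?_, fun t ↦ hα ?_⟩
  · rw [map_add, hr, hr, hr, map_add, map_add]
    abel
  · rw [AddMonoidHom.mk'_apply, hr, (hexact (α t)).2 ⟨t, rfl⟩, map_zero, sub_zero]

end AbelianGroup

/-! ### Abelianizations -/

namespace FPResolution

open MonoidAlgebra

variable {β : Type u} [Group β]

lemma finite_ker_augmentation (R : FPResolution β) :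
    Module.Finite ℤ[β] (RingHom.ker (augmentation β)) := by
  obtain ⟨f, hf⟩ := R.exists_linearMap_augmentation_eq
  obtain ⟨p, hp⟩ := R.ε_surjective 1
  let F : R.P 1 × ℤ[β] →ₗ[ℤ[β]] RingHom.ker (augmentation β) :=
    ((f ∘ₗ R.d 0).coprod (LinearMap.toSpanSingleton ℤ[β] _ (1 - f p))).codRestrict _ fun y ↦ by
      simp [RingHom.mem_ker, hf, hp, R.exact_zero.apply_apply_eq_zero y.1]
  refine Module.Finite.of_surjective F fun x ↦ ?_
  obtain ⟨y, hy⟩ := (R.exact_zero ((x : ℤ[β]) • p)).1 (by simp [(RingHom.mem_ker).1 x.2])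
  exact ⟨(y, x), Subtype.ext (by simp [F, hy, mul_sub])⟩

/-- `βᵃᵇ` is a quotient of the augmentation ideal, by the derivation `β → βᵃᵇ`. -/
lemma fg_abelianization (R : FPResolution β) : Group.FG (Abelianization β) := by
  let : Module ℤ[β] (Additive (Abelianization β)) := Module.compHom _ (augmentation β)
  have hsmul (r : ℤ[β]) (x : Additive (Abelianization β)) : r • x = augmentation β r • x := rfl
  obtain ⟨θ, hθ⟩ := exists_linearMap_of_derivation
    (fun g : β ↦ Additive.ofMul (Abelianization.of g))
    (fun g h ↦ by rw [hsmul, augmentation_single, one_smul, map_mul, ofMul_mul])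
  have := R.finite_ker_augmentation
  have hfin : Module.Finite ℤ[β] (Additive (Abelianization β)) :=
    Module.Finite.of_surjective θ fun x ↦ by
      obtain ⟨g, hg⟩ : ∃ g, Abelianization.of g = x.toMul :=
        QuotientGroup.mk_surjective _
      exact ⟨_, (hθ g).trans (congrArg Additive.ofMul hg)⟩
  obtain ⟨S, hS⟩ := hfin.fg_top
  let N : Submodule ℤ[β] (Additive (Abelianization β)) :=
    { AddSubgroup.closure (S : Set (Additive (Abelianization β))) with
      smul_mem' := fun r x hx ↦ by
        rw [hsmul]
        exact AddSubgroup.zsmul_mem _ hx _ }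
  rw [GroupFG.iff_add_fg]
  refine ⟨⟨S, top_le_iff.1 fun x _ ↦ ?_⟩⟩
  have : Submodule.span ℤ[β] (S : Set (Additive (Abelianization β))) ≤ N :=
    Submodule.span_le.2 AddSubgroup.subset_closure
  exact this (hS ▸ Submodule.mem_top)

end FPResolution

section Extension

open MonoidAlgebra
open scoped IsMulCommutative

variable {G : Type u} [Group G] (A : Subgroup G) [A.Normal]

/-- The map `A / [G, A] → Gᵃᵇ` induced by the inclusion. -/
def quotientCommutatorToAbelianization :
    A ⧸ (⁅(⊤ : Subgroup G), A⁆).subgroupOf A →* Abelianization G :=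
  QuotientGroup.lift _ (Abelianization.of.comp A.subtype) fun a ha ↦ by
    rw [← MonoidHom.comap_ker, Abelianization.ker_of]
    exact Subgroup.commutator_mono le_rfl le_top (Subgroup.mem_subgroupOf.1 ha)

lemma map_mk'_eq_one_iff (x : Abelianization G) :
    Abelianization.map (QuotientGroup.mk' A) x = 1 ↔
      x ∈ (quotientCommutatorToAbelianization A).range := by
  obtain ⟨g, rfl⟩ : ∃ g, Abelianization.of g = x := QuotientGroup.mk_surjective x
  constructor
  · intro hg
    rw [Abelianization.map_of, ← MonoidHom.mem_ker, Abelianization.ker_of, commutator_def,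
      ← Subgroup.map_top_of_surjective _ (QuotientGroup.mk'_surjective A),
      ← Subgroup.map_commutator] at hg
    obtain ⟨c, hc, hcg⟩ := hg
    have hc1 : Abelianization.of c = 1 := by
      rwa [← MonoidHom.mem_ker, Abelianization.ker_of]
    refine ⟨QuotientGroup.mk ⟨c⁻¹ * g, QuotientGroup.eq.1 hcg⟩, ?_⟩
    change Abelianization.of (c⁻¹ * g) = _
    rw [map_mul, map_inv, hc1, inv_one, one_mul]
  · rintro ⟨a, ha⟩
    obtain ⟨a, rfl⟩ := QuotientGroup.mk_surjective a
    rw [← ha]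
    change Abelianization.of ((a : G) : G ⧸ A) = 1
    rw [(QuotientGroup.eq_one_iff (a : G)).2 a.2, map_one]

variable [IsMulCommutative A]

/-- A section `s` gives `G = A ⋊ s(G ⧸ A)`, and hence the isomorphism
`g ↦ ([g (s ḡ)⁻¹], [ḡ])`. -/
lemma nonempty_mulEquiv_of_section (s : G ⧸ A →* G)
    (hs : (QuotientGroup.mk' A).comp s = MonoidHom.id (G ⧸ A)) :
    Nonempty (Abelianization G ≃*
      (A ⧸ (⁅(⊤ : Subgroup G), A⁆).subgroupOf A) × Abelianization (G ⧸ A)) := by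
  have hs (x) : ((s x : G) : G ⧸ A) = x := DFunLike.congr_fun hs x
  let c (g : G) : A := ⟨g * (s g)⁻¹, by rw [← QuotientGroup.eq_one_iff]; simp [hs]⟩
  have hconj (g : G) (a : A) :
      (QuotientGroup.mk (MulAut.conjNormal g a) : A ⧸ (⁅(⊤ : Subgroup G), A⁆).subgroupOf A) =
        QuotientGroup.mk a := by
    rw [eq_comm, QuotientGroup.eq, Subgroup.mem_subgroupOf, mul_comm']
    exact Subgroup.commutator_mem_commutator (Subgroup.mem_top g) a.2
  let ρ : G →* A ⧸ (⁅(⊤ : Subgroup G), A⁆).subgroupOf A :=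
    MonoidHom.mk' (fun g ↦ QuotientGroup.mk (c g)) fun g h ↦ by
      have : c (g * h) = MulAut.conjNormal g (c h) * c g := by ext; simp [c, mul_assoc]
      rw [this, QuotientGroup.mk_mul, hconj, mul_comm]
  have hρs (x) : ρ (s x) = 1 := (QuotientGroup.eq_one_iff _).2 (by
    have : c (s x) = 1 := by ext; simp [c, hs]
    rw [this]; exact one_mem _)
  have hρA (a : A) : ρ a = QuotientGroup.mk a := by
    have : c a = a := by ext; simp [c, (QuotientGroup.eq_one_iff (a : G)).2 a.2]
    exact congrArg QuotientGroup.mk this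
  refine ⟨MonoidHom.toMulEquiv
    ((Abelianization.lift ρ).prod (Abelianization.map (QuotientGroup.mk' A)))
    ((quotientCommutatorToAbelianization A).coprod (Abelianization.map s)) ?_ ?_⟩
  · ext g
    change Abelianization.of (g * (s g)⁻¹) * Abelianization.of (s g) = Abelianization.of g
    rw [← map_mul, inv_mul_cancel_right]
  · refine MonoidHom.ext fun ⟨a, b⟩ ↦ ?_
    obtain ⟨a, rfl⟩ := QuotientGroup.mk_surjective a
    obtain ⟨x, rfl⟩ : ∃ x, Abelianization.of x = b := QuotientGroup.mk_surjective b
    refine Prod.ext ?_ ?_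
    · change ρ (a * s x) = _
      rw [map_mul, hρA, hρs, mul_one]
      rfl
    · change Abelianization.of ((a * s x : G) : G ⧸ A) = Abelianization.of x
      rw [QuotientGroup.mk_mul, (QuotientGroup.eq_one_iff (a : G)).2 a.2, hs, one_mul]

end Extension

end

theorem lemma2 {G : Type*} [Group G] (A : Subgroup G) [A.Normal] [IsMulCommutative A]
    (hA : A.FG) (hβ : IsOrientablePDGroup 2 (G ⧸ A)) :
    (∃ s : G ⧸ A →* G, (QuotientGroup.mk' A).comp s = MonoidHom.id (G ⧸ A)) ↔
      Nonempty (Abelianization G ≃*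
        (A ⧸ (⁅(⊤ : Subgroup G), A⁆).subgroupOf A) × Abelianization (G ⧸ A)) := by
  refine ⟨fun ⟨s, hs⟩ ↦ nonempty_mulEquiv_of_section A s hs, fun ⟨f⟩ ↦ ?_⟩
  obtain ⟨R, hR, e, he⟩ := hβ
  have : Group.FG A := (Group.fg_iff_subgroup_fg A).2 hA
  have := R.fg_abelianization
  open scoped IsMulCommutative in
  obtain ⟨r, hr⟩ := exists_retraction_of_addEquiv_prod
    (MonoidHom.toAdditive (quotientCommutatorToAbelianization A))
    (MonoidHom.toAdditive (Abelianization.map (QuotientGroup.mk' A)))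
    (fun b ↦ by
      obtain ⟨g, rfl⟩ : ∃ g : G, Additive.ofMul (Abelianization.of (g : G ⧸ A)) = b :=
        ((QuotientGroup.mk_surjective (s := commutator (G ⧸ A))).comp
          (QuotientGroup.mk_surjective (s := A))) b.toMul
      exact ⟨Additive.ofMul (Abelianization.of g), rfl⟩)
    (map_mk'_eq_one_iff A)
    ((MulEquiv.toAdditive f).trans (AddEquiv.prodAdditive _ _))
  exact exists_section_of_retraction R (fun i hi ↦ hR i (by omega)) (fun g x ↦ e.injective (he g x))
    ((MonoidHom.toAdditive.symm r).comp Abelianization.of) fun a ↦ hr (QuotientGroup.mk a)
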